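/- Let $H$ be a complex Hilbert space and $\theta\in[0,\frac{\pi}{2})$; write $\Sigma_\theta=\{re^{i\alpha}: r\ge 0,\ |\alpha|\le\theta\}$. For every $n\in\mathbb{N}=\{1,2,\dots\}$ let $\mathfrak{b}_n$ be a sesquilinear form in $H$, with domain a (not necessarily dense) subspace $D(\mathfrak{b}_n)$ of $H$, which is sectorial with vertex $0$ and semi-angle $\theta$, i.e. $\mathfrak{b}_n(u,u)\in\Sigma_\theta$ for all $u\in D(\mathfrak{b}_n)$; the forms need be neither closed nor closable. Let $\mathfrak{a}_n=\sum_{k=1}^n\mathfrak{b}_k$, with $D(\mathfrak{a}_n)=\bigcap_{k=1}^n D(\mathfrak{b}_k)$. A graph in $H$ is a subspace $A$ of $H\times H$; its domain is $D(A)=\{x : (x,y)\in A\text{ for some }y\}$; it is single-valued (an operator) if $\{y:(0,y)\in A\}=\{0\}$; it is invertible if it is closed, for every $y\in H$ there is an $x$ with $(x,y)\in A$, and $\{x:(x,0)\in A\}=\{0\}$. Put $A-\lambda I=\{(x,y-\lambda x):(x,y)\in A\}$, and let $\rho(A)$ be the set of all $\lambda\in\mathbb{C}$ for which $A-\lambda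 I$ is invertible. The graph $A$ is m-sectorial if there are $\gamma\in\mathbb{R}$ and $\theta'\in[0,\frac{\pi}{2})$ such that $(x,y)_H\in\Sigma_{\theta'}$ for all $(x,y)\in A-\gamma I$ and $A-(\gamma-1)I$ is invertible. Let $A_n$ be the graph associated with $\mathfrak{a}_n$: the set of all $(x,f)\in H\times H$ for which there is a sequence $(u_m)_{m\in\mathbb{N}}$ in $D(\mathfrak{a}_n)$ with $u_m\to x$ in $H$, $\{\mathfrak{a}_n(u_m,u_m):m\in\mathbb{N}\}$ bounded, and $\lim_{m\to\infty}\mathfrak{a}_n(u_m,v)=(f,v)_H$ for all $v\in D(\mathfrak{a}_n)$. We say that $A_n\to B$ in the strong resolvent sense if for every $\lambda\in\mathbb{C}$ with $\operatorname{Re}\lambda<0$ one has $\lambda\in\rho(B)\cap\bigcap_n\rho(A_n)$ and $(A_n-\lambda I)^{-1}f\to(B-\lambda I)^{-1}f$ in $H$ for all $f\in H$. Finally let $$D(\mathfrak{a}_\infty)=\Big\{u\in\bigcap_{n=1}^\infty D(\mathfrak{b}_n) : \sum_{n=1}^\infty\operatorname{Re}\mathfrak{b}_n(u,u)\text{ is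 convergent}\Big\}.$$ Then there is a unique m-sectorial graph $A_\infty$ in $H$ such that $A_n\to A_\infty$ in the strong resolvent sense, and it satisfies $$\overline{D(\mathfrak{a}_\infty)}\subset\overline{D(A_\infty)}.$$ In particular, if $D(\mathfrak{a}_\infty)$ is dense in $H$, then $A_\infty$ is single-valued, i.e. an m-sectorial operator. -/

import Mathlib

open Filter Topology

noncomputable section

/-- The closed sector `Σ_θ = { r e^{iα} : r ≥ 0, |α| ≤ θ }`. -/
def sector (θ : ℝ) : Set ℂ :=
  {z | ∃ r α : ℝ, 0 ≤ r ∧ |α| ≤ θ ∧ z = (r : ℂ) * Complex.exp ((α : ℂ) * Complex.I)}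

theorem mem_sector_iff {θ : ℝ} (h0 : 0 ≤ θ) (h1 : θ < Real.pi / 2) (z : ℂ) :
    z ∈ sector θ ↔ 0 ≤ z.re ∧ |z.im| ≤ Real.tan θ * z.re := by
  constructor
  · rintro ⟨r, α, hr, hα, rfl⟩
    have hre : ((r : ℂ) * Complex.exp ((α : ℂ) * Complex.I)).re = r * Real.cos α := by
      rw [Complex.re_ofReal_mul, Complex.exp_ofReal_mul_I_re]
    have him : ((r : ℂ) * Complex.exp ((α : ℂ) * Complex.I)).im = r * Real.sin α := by
      rw [Complex.im_ofReal_mul, Complex.exp_ofReal_mul_I_im]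
    have hα' := abs_le.1 hα
    have hc : 0 < Real.cos α := Real.cos_pos_of_mem_Ioo ⟨by linarith, by linarith⟩
    have htan : |Real.tan α| ≤ Real.tan θ := by
      rw [abs_le]
      constructor
      · rw [← Real.tan_neg]
        exact Real.strictMonoOn_tan.monotoneOn ⟨by linarith, by linarith⟩
          ⟨by linarith, by linarith⟩ hα'.1
      · exact Real.strictMonoOn_tan.monotoneOn ⟨by linarith, by linarith⟩
          ⟨by linarith, by linarith⟩ hα'.2
    have hsin : Real.sin α = Real.tan α * Real.cos α :=
      (Real.tan_mul_cos hc.ne').symm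
    rw [hre, him]
    refine ⟨by positivity, ?_⟩
    rw [hsin, abs_mul, abs_mul, abs_of_nonneg hr, abs_of_pos hc]
    have : r * (|Real.tan α| * Real.cos α) ≤ r * (Real.tan θ * Real.cos α) := by gcongr
    linarith
  · rintro ⟨hre, him⟩
    rcases hre.eq_or_lt with h | h
    · have : z = 0 := by
        apply Complex.ext
        · simpa using h.symm
        · rw [← h, mul_zero] at him
          simpa using him
      exact ⟨0, 0, le_rfl, by simpa using h0, by simp [this]⟩
    · refine ⟨‖z‖, z.arg, norm_nonneg _, ?_, (Complex.norm_mul_exp_arg_mul_I z).symm⟩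
      have harg : |z.arg| < Real.pi / 2 := Complex.abs_arg_lt_pi_div_two_iff.2 (Or.inl h)
      have harg' := abs_lt.1 harg
      have ht : |Real.tan z.arg| ≤ Real.tan θ := by
        rw [Complex.tan_arg, abs_div, abs_of_pos h, div_le_iff₀ h]
        exact him
      have ht' := abs_le.1 ht
      rw [← Real.tan_neg] at ht'
      rw [abs_le]
      constructor
      · exact (Real.strictMonoOn_tan.le_iff_le (a := -θ) (b := z.arg)
          ⟨by linarith, by linarith⟩ ⟨by linarith, by linarith⟩).1 ht'.1
      · exact (Real.strictMonoOn_tan.le_iff_le (a := z.arg) (b := θ)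
          ⟨by linarith, by linarith⟩ ⟨by linarith, by linarith⟩).1 ht'.2

/-- A graph (linear relation) in `H`: a subspace of `H × H`. -/
abbrev LinGraph (H : Type*) [NormedAddCommGroup H] [InnerProductSpace ℂ H] : Type _ :=
  Submodule ℂ (H × H)

/-- A sesquilinear form in `H`: a subspace `D(a)` of `H` together with a map
`D(a) × D(a) → ℂ` that is linear in the first and conjugate linear in the second variable. -/
structure SesqForm (H : Type*) [NormedAddCommGroup H] [InnerProductSpace ℂ H] where
  /-- The form domain `D(a)`. -/
  dom : Submodule ℂ H
  /-- The values `a(u, v)`. -/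
  form : dom →ₗ[ℂ] dom →ₗ⋆[ℂ] ℂ

section

variable {H : Type*} [NormedAddCommGroup H] [InnerProductSpace ℂ H]

/-- The domain `D(A)` of a graph. -/
def LinGraph.dom (A : LinGraph H) : Set H := {x | ∃ y, (x, y) ∈ A}

/-- A graph is single-valued, i.e. an operator, if `{ y : (0, y) ∈ A } = {0}`. -/
def LinGraph.IsSingleValued (A : LinGraph H) : Prop := {y : H | ((0 : H), y) ∈ A} = {0}

/-- A graph is invertible if it is surjective, closed, and its reflection
`{ (y, x) : (x, y) ∈ A }` is single-valued. -/
def LinGraph.IsInvertible (A : LinGraph H) : Prop :=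
  (∀ y, ∃ x, (x, y) ∈ A) ∧ IsClosed (A : Set (H × H)) ∧ {x : H | (x, (0 : H)) ∈ A} = {0}

/-- The graph `A - z I = { (x, y - z x) : (x, y) ∈ A }`. -/
def LinGraph.subScalar (A : LinGraph H) (z : ℂ) : LinGraph H :=
  A.map ((LinearMap.fst ℂ H H).prod (LinearMap.snd ℂ H H - z • LinearMap.fst ℂ H H))

theorem LinGraph.mem_subScalar (A : LinGraph H) (z : ℂ) (x y : H) :
    (x, y) ∈ A.subScalar z ↔ (x, y + z • x) ∈ A := by
  constructor
  · rintro ⟨⟨a, b⟩, hab, h⟩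
    obtain ⟨rfl, rfl⟩ := Prod.mk.inj h
    simpa using hab
  · intro h
    exact ⟨_, h, by simp⟩

/-- The resolvent set `ρ(A)`: all `z` such that `A - z I` is invertible. -/
def LinGraph.resolventSet (A : LinGraph H) : Set ℂ := {z | (A.subScalar z).IsInvertible}

/-- A graph is m-sectorial if there are `γ ∈ ℝ` and `θ ∈ [0, π/2)` such that
`(x, y)_H ∈ Σ_θ` for all `(x, y) ∈ A - γ I` and `A - (γ - 1) I` is invertible.
(The inner product `(x, y)_H`, linear in `x`, is `inner ℂ y x` in Mathlib.) -/
def LinGraph.IsMSectorial (A : LinGraph H) : Prop :=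
  ∃ γ θ : ℝ, 0 ≤ θ ∧ θ < Real.pi / 2 ∧
    (∀ x y : H, (x, y) ∈ A.subScalar (γ : ℂ) → inner ℂ y x ∈ sector θ) ∧
    (A.subScalar ((γ : ℂ) - 1)).IsInvertible

/-- Strong resolvent convergence `A_n → B`, on the half-plane `{ Re z < 0 }` (all graphs to which
this is applied come from forms with vertex `0`): every such `z` lies in all the
resolvent sets, and `(A_n - z I)⁻¹ f → (B - z I)⁻¹ f` in `H` for every `f`.
Here `(A - z I)⁻¹ f` is the unique `x` with `(x, f) ∈ A - z I`. -/
def LinGraph.StrongResolventTendsto (A : ℕ → LinGraph H) (B : LinGraph H) : Prop :=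
  ∀ z : ℂ, z.re < 0 →
    (∀ n, z ∈ (A n).resolventSet) ∧ z ∈ B.resolventSet ∧
    ∀ (f : H) (x : ℕ → H) (y : H),
      (∀ n, (x n, f) ∈ (A n).subScalar z) → (y, f) ∈ B.subScalar z →
        Tendsto x atTop (𝓝 y)

/-- `a` is sectorial with vertex `γ` and semi-angle `θ`:
`a(u, u) - γ ‖u‖² ∈ Σ_θ` for all `u ∈ D(a)`. -/
def SesqForm.IsSectorialWith (a : SesqForm H) (γ θ : ℝ) : Prop :=
  0 ≤ θ ∧ θ < Real.pi / 2 ∧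
    ∀ u : a.dom, a.form u u - ((γ * ‖(u : H)‖ ^ 2 : ℝ) : ℂ) ∈ sector θ

/-- `a` is sectorial if it has some vertex and some semi-angle. -/
def SesqForm.IsSectorial (a : SesqForm H) : Prop := ∃ γ θ : ℝ, a.IsSectorialWith γ θ

/-- `(x, f)` belongs to the graph associated with `a`: there is a sequence `u_n` in `D(a)` with
`u_n → x` in `H`, `{ a(u_n, u_n) }` bounded, and `a(u_n, v) → (f, v)_H` for all `v ∈ D(a)`.
(The inner product `(f, v)_H`, linear in `f`, is `inner ℂ v f` in Mathlib.) -/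
def SesqForm.MemGraph (a : SesqForm H) (p : H × H) : Prop :=
  ∃ u : ℕ → a.dom,
    Tendsto (fun n => (u n : H)) atTop (𝓝 p.1) ∧
    Bornology.IsBounded (Set.range fun n => a.form (u n) (u n)) ∧
    ∀ v : a.dom, Tendsto (fun n => a.form (u n) v) atTop (𝓝 (inner ℂ (v : H) p.2))

theorem SesqForm.memGraph_add {a : SesqForm H} (ha : a.IsSectorial) {p q : H × H}
    (hp : a.MemGraph p) (hq : a.MemGraph q) : a.MemGraph (p + q) := by
  obtain ⟨γ, θ, h0, h1, hs⟩ := ha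
  obtain ⟨u, hu, hub, huv⟩ := hp
  obtain ⟨w, hw, hwb, hwv⟩ := hq
  have hadd : Tendsto (fun n => ((u n + w n : a.dom) : H)) atTop (𝓝 (p.1 + q.1)) := by
    simpa using hu.add hw
  have hsub : Tendsto (fun n => ((u n - w n : a.dom) : H)) atTop (𝓝 (p.1 - q.1)) := by
    simpa using hu.sub hw
  refine ⟨fun n => u n + w n, hadd, ?_, ?_⟩
  · obtain ⟨C, hC⟩ := hub.exists_norm_le
    obtain ⟨C', hC'⟩ := hwb.exists_norm_le
    obtain ⟨S, hS⟩ := (Metric.isBounded_range_of_tendsto _ hadd).exists_norm_le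
    obtain ⟨T, hT⟩ := (Metric.isBounded_range_of_tendsto _ hsub).exists_norm_le
    have key : ∀ x : a.dom, γ * ‖(x : H)‖ ^ 2 ≤ (a.form x x).re ∧
        |(a.form x x).im| ≤ Real.tan θ * ((a.form x x).re - γ * ‖(x : H)‖ ^ 2) := by
      intro x
      have := (mem_sector_iff h0 h1 _).1 (hs x)
      simp only [Complex.sub_re, Complex.sub_im, Complex.ofReal_re, Complex.ofReal_im,
        sub_zero, sub_nonneg] at this
      exact this
    have ht : 0 ≤ Real.tan θ := Real.tan_nonneg_of_nonneg_of_le_pi_div_two h0 h1.le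
    rw [isBounded_iff_forall_norm_le]
    refine ⟨(|γ| * S ^ 2 + (2 * C + 2 * C' + |γ| * T ^ 2)) +
      Real.tan θ * (2 * C + 2 * C' + |γ| * T ^ 2 + |γ| * S ^ 2), ?_⟩
    rintro _ ⟨n, rfl⟩
    have e1 : ‖a.form (u n) (u n)‖ ≤ C := hC _ ⟨n, rfl⟩
    have e2 : ‖a.form (w n) (w n)‖ ≤ C' := hC' _ ⟨n, rfl⟩
    have e3 : ‖((u n + w n : a.dom) : H)‖ ≤ S := hS _ ⟨n, rfl⟩
    have e4 : ‖((u n - w n : a.dom) : H)‖ ≤ T := hT _ ⟨n, rfl⟩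
    have par : (a.form (u n + w n) (u n + w n)).re + (a.form (u n - w n) (u n - w n)).re
        = 2 * (a.form (u n) (u n)).re + 2 * (a.form (w n) (w n)).re := by
      simp only [map_add, map_sub, LinearMap.add_apply, LinearMap.sub_apply, Complex.add_re,
        Complex.sub_re]
      ring
    have r1 := (Complex.abs_re_le_norm _).trans e1
    have r2 := (Complex.abs_re_le_norm _).trans e2
    have g3 : |γ * ‖((u n + w n : a.dom) : H)‖ ^ 2| ≤ |γ| * S ^ 2 := by
      rw [abs_mul, abs_pow, abs_norm]
      gcongr
    have g4 : |γ * ‖((u n - w n : a.dom) : H)‖ ^ 2| ≤ |γ| * T ^ 2 := by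
      rw [abs_mul, abs_pow, abs_norm]
      gcongr
    have k1 := key (u n + w n)
    have k2 := key (u n - w n)
    have up : (a.form (u n + w n) (u n + w n)).re ≤ 2 * C + 2 * C' + |γ| * T ^ 2 := by
      linarith [(abs_le.1 r1).2, (abs_le.1 r2).2, (abs_le.1 g4).1]
    have hsum : |(a.form (u n + w n) (u n + w n)).re| ≤
        |γ| * S ^ 2 + (2 * C + 2 * C' + |γ| * T ^ 2) := by
      have n1 : 0 ≤ |γ| * S ^ 2 := (abs_nonneg _).trans g3
      have n2 : 0 ≤ |γ| * T ^ 2 := (abs_nonneg _).trans g4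
      have n3 : 0 ≤ C := (norm_nonneg _).trans e1
      have n4 : 0 ≤ C' := (norm_nonneg _).trans e2
      rw [abs_le]
      constructor <;> linarith [(abs_le.1 g3).1]
    have him : |(a.form (u n + w n) (u n + w n)).im| ≤
        Real.tan θ * (2 * C + 2 * C' + |γ| * T ^ 2 + |γ| * S ^ 2) := by
      refine k1.2.trans (mul_le_mul_of_nonneg_left ?_ ht)
      linarith [(abs_le.1 g3).1]
    exact (Complex.norm_le_abs_re_add_abs_im _).trans (add_le_add hsum him)
  · intro v
    have := (huv v).add (hwv v)
    simpa [inner_add_right] using this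

theorem SesqForm.memGraph_smul {a : SesqForm H} (c : ℂ) {p : H × H}
    (hp : a.MemGraph p) : a.MemGraph (c • p) := by
  obtain ⟨u, hu, hub, huv⟩ := hp
  refine ⟨fun n => c • u n, ?_, ?_, ?_⟩
  · simpa using hu.const_smul c
  · obtain ⟨C, hC⟩ := hub.exists_norm_le
    rw [isBounded_iff_forall_norm_le]
    refine ⟨‖c‖ * (‖c‖ * C), ?_⟩
    rintro _ ⟨n, rfl⟩
    have e : ‖a.form (u n) (u n)‖ ≤ C := hC _ ⟨n, rfl⟩
    have : a.form (c • u n) (c • u n) = c * (starRingEnd ℂ c * a.form (u n) (u n)) := by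
      simp only [map_smul, LinearMap.map_smulₛₗ, LinearMap.smul_apply, smul_eq_mul]
      ring
    change ‖a.form (c • u n) (c • u n)‖ ≤ _
    rw [this, norm_mul, norm_mul, RCLike.norm_conj]
    gcongr
  · intro v
    have := (huv v).const_mul c
    simpa [inner_smul_right] using this

/-- The graph associated with a (not necessarily closed or densely defined) sectorial form. -/
def SesqForm.graph (a : SesqForm H) (ha : a.IsSectorial) : LinGraph H where
  carrier := {p | a.MemGraph p}
  add_mem' := fun hp hq => SesqForm.memGraph_add ha hp hq
  zero_mem' := ⟨fun _ => 0, by simp, by simp, by simp⟩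
  smul_mem' := fun c _ hp => SesqForm.memGraph_smul c hp

/-- The partial sum `a_n = b_0 + ⋯ + b_n` with domain `D(a_n) = D(b_0) ∩ ⋯ ∩ D(b_n)`. -/
def SesqForm.partialSum (b : ℕ → SesqForm H) (n : ℕ) : SesqForm H where
  dom := ⨅ k : Fin (n + 1), (b k).dom
  form := LinearMap.mk₂'ₛₗ (RingHom.id ℂ) (starRingEnd ℂ)
    (fun u v => ∑ k : Fin (n + 1),
      (b k).form ⟨u, (Submodule.mem_iInf _).1 u.2 k⟩ ⟨v, (Submodule.mem_iInf _).1 v.2 k⟩)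
    (fun u u' v => by
      rw [← Finset.sum_add_distrib]
      refine Finset.sum_congr rfl fun k _ => ?_
      rw [← LinearMap.add_apply, ← map_add]
      rfl)
    (fun c u v => by
      rw [Finset.smul_sum]
      refine Finset.sum_congr rfl fun k _ => ?_
      rw [RingHom.id_apply, ← LinearMap.smul_apply, ← map_smul]
      rfl)
    (fun u v v' => by
      rw [← Finset.sum_add_distrib]
      refine Finset.sum_congr rfl fun k _ => ?_
      rw [← map_add]
      rfl)
    (fun c u v => by
      rw [Finset.smul_sum]
      refine Finset.sum_congr rfl fun k _ => ?_
      rw [← LinearMap.map_smulₛₗ]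
      rfl)

theorem SesqForm.partialSum_form_apply (b : ℕ → SesqForm H) (n : ℕ)
    (u v : (SesqForm.partialSum b n).dom) :
    (SesqForm.partialSum b n).form u v = ∑ k : Fin (n + 1),
      (b k).form ⟨u, (Submodule.mem_iInf _).1 u.2 k⟩ ⟨v, (Submodule.mem_iInf _).1 v.2 k⟩ :=
  rfl

/-- A finite sum of sectorial forms with vertex `0` and semi-angle `θ` is again such a form. -/
theorem SesqForm.partialSum_isSectorial {θ : ℝ} {b : ℕ → SesqForm H}
    (hb : ∀ n, (b n).IsSectorialWith 0 θ) (n : ℕ) :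
    (SesqForm.partialSum b n).IsSectorial := by
  have h0 := (hb 0).1
  have h1 := (hb 0).2.1
  refine ⟨0, θ, h0, h1, fun u => ?_⟩
  rw [mem_sector_iff h0 h1, SesqForm.partialSum_form_apply]
  have key : ∀ k : ℕ, ∀ x : (b k).dom, 0 ≤ ((b k).form x x).re ∧
      |((b k).form x x).im| ≤ Real.tan θ * ((b k).form x x).re := by
    intro k x
    have := (mem_sector_iff h0 h1 _).1 ((hb k).2.2 x)
    simpa using this
  simp only [zero_mul, Complex.ofReal_zero, sub_zero, Complex.re_sum, Complex.im_sum]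
  refine ⟨Finset.sum_nonneg fun k _ => (key _ _).1, ?_⟩
  rw [Finset.mul_sum]
  exact (Finset.abs_sum_le_sum_abs _ _).trans (Finset.sum_le_sum fun k _ => (key _ _).2)

/-- `D(a_∞)`: all `u ∈ ⋂ₙ D(b_n)` for which the series `∑ₙ Re b_n(u, u)` converges.
(The terms are nonnegative where this is used, so convergence is summability.) -/
def SesqForm.limitDomain (b : ℕ → SesqForm H) : Set H :=
  {u | ∃ h : ∀ n, u ∈ (b n).dom, Summable fun n => ((b n).form ⟨u, h n⟩ ⟨u, h n⟩).re}

end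

end

/-! The form sum is turned into one fixed bounded operator, so that only a subspace varies with `n`.
Completing each `D(b_k)` in the seminorm given by `Re b_k` yields a Hilbert space `K k`, a map `q k`
into it, and a bounded `T k` representing `b_k` with `Re (T k w, w) = ‖w‖ ^ 2`. The bound on `T k`
depends only on `θ`, so the `T k` combine to a bounded operator on `E = H ⊕ ℓ²-sum of the K k`, zero
on `H`; let `J : E → H` be the first projection.

In `E` let `W n` be the closure of the vectors `(u, w)` with `w k = q k u` for `k ≤ n` and arbitrary
components for `k > n`. The graph of the `n`-th partial sum is the graph of the fixed form
restricted to `W n` (`memGraph_partialSum_iff`): test vectors with zero tail do not see the free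
tail. Taking the closure in `E` means that closability is never needed.

Freeing the tail makes `W n` decreasing. Resolvents are Lax–Milgram solutions on `W n`, and these
converge to the solution on `⨅ n, W n` (`tendsto_coercive_solution`). The graph on this intersection
is `A_∞`. A `u` in the limit domain lifts to `(u, (q k u)_k)`, which lies in every `W n`; the
closure of `D(A_∞)` contains `J (⨅ n, W n)` by duality (`IsElliptic.image_subset_closure_dom`). -/

open Filter Topology

noncomputable section

/-! ### Coercive problems on closed subspaces. -/

section Coercive

variable {E : Type*} [NormedAddCommGroup E] [InnerProductSpace ℂ E]

/-- The a priori estimate for a coercive problem on a subspace. -/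
theorem norm_coercive_solution_le {W : Submodule ℂ E} (S : E →L[ℂ] E) {c : ℝ}
    (hS : ∀ w, c * ‖w‖ ^ 2 ≤ (inner ℂ w (S w)).re) {g w : E} (hw : w ∈ W)
    (hwS : ∀ v ∈ W, inner ℂ v (S w) = inner ℂ v g) : c * ‖w‖ ≤ ‖g‖ := by
  have h1 : c * ‖w‖ ^ 2 ≤ ‖w‖ * ‖g‖ := by
    refine (hS w).trans ?_
    rw [hwS w hw]
    exact (Complex.re_le_norm _).trans (norm_inner_le_norm _ _)
  rcases (norm_nonneg w).eq_or_lt with h | h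
  · rw [← h, mul_zero]
    exact norm_nonneg _
  · nlinarith

/-- Lax–Milgram for complex Hilbert spaces: a coercive operator is surjective. -/
theorem surjective_of_coercive [CompleteSpace E] (S : E →L[ℂ] E) {c : ℝ} (hc : 0 < c)
    (hS : ∀ w, c * ‖w‖ ^ 2 ≤ (inner ℂ w (S w)).re) : Function.Surjective S := by
  have hb : ∀ w, c * ‖w‖ ≤ ‖S w‖ := fun w =>
    norm_coercive_solution_le (W := ⊤) S hS trivial fun _ _ => rfl
  have hanti : AntilipschitzWith (Real.toNNReal c⁻¹) S := by
    refine S.antilipschitz_of_bound fun w => ?_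
    rw [Real.coe_toNNReal _ (inv_pos.2 hc).le, inv_mul_eq_div, le_div_iff₀ hc, mul_comm]
    exact hb w
  have hclosed : IsClosed (S.range : Set E) := hanti.isClosed_range S.uniformContinuous
  have : CompleteSpace S.range := hclosed.completeSpace_coe
  have htop : S.range = ⊤ := by
    rw [← Submodule.orthogonal_eq_bot_iff, Submodule.eq_bot_iff]
    intro v hv
    have h0 : inner ℂ v (S v) = 0 := (Submodule.mem_orthogonal' _ _).1 hv _ ⟨v, rfl⟩
    have := hS v
    rw [h0, Complex.zero_re] at this
    have h2 : ‖v‖ ^ 2 = 0 := by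
      have := sq_nonneg ‖v‖
      nlinarith
    simpa using h2
  exact LinearMap.range_eq_top.1 htop

/-- Lax–Milgram on a closed subspace. -/
theorem exists_coercive_solution [CompleteSpace E] {W : Submodule ℂ E} (hW : IsClosed (W : Set E)) (S : E →L[ℂ] E)
    {c : ℝ} (hc : 0 < c) (hS : ∀ w, c * ‖w‖ ^ 2 ≤ (inner ℂ w (S w)).re) (g : E) :
    ∃ w ∈ W, ∀ v ∈ W, inner ℂ v (S w) = inner ℂ v g := by
  have : CompleteSpace W := hW.completeSpace_coe
  obtain ⟨w, hw⟩ := surjective_of_coercive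
    (W.orthogonalProjectionOnto ∘L S ∘L W.subtypeL) hc
    (fun w => by simpa using hS w) (W.orthogonalProjectionOnto g)
  refine ⟨w, w.2, fun v hv => ?_⟩
  have := congrArg (fun x : W => inner ℂ (⟨v, hv⟩ : W) x) hw
  simpa using this

/-- Solutions of a coercive problem on a decreasing sequence of closed subspaces converge to the
solution on the intersection. -/
theorem tendsto_coercive_solution [CompleteSpace E] {W : ℕ → Submodule ℂ E} (hW : ∀ n, IsClosed (W n : Set E))
    (hanti : Antitone W) (S : E →L[ℂ] E) {c : ℝ} (hc : 0 < c)
    (hS : ∀ w, c * ‖w‖ ^ 2 ≤ (inner ℂ w (S w)).re) {g : E} {w : ℕ → E} {w' : E}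
    (hw : ∀ n, w n ∈ W n) (hwS : ∀ n, ∀ v ∈ W n, inner ℂ v (S (w n)) = inner ℂ v g)
    (hw' : w' ∈ ⨅ n, W n) (hwS' : ∀ v ∈ ⨅ n, W n, inner ℂ v (S w') = inner ℂ v g) :
    Tendsto w atTop (𝓝 w') := by
  have : ∀ n, CompleteSpace (W n) := fun n => (hW n).completeSpace_coe
  set h := g - S w' with hh
  -- The residual `h` annihilates the intersection of the `W n`, and the orthogonal complement of
  -- that intersection is the closure of the sum of the `(W n)ᗮ`.
  have hmem : h ∈ (⨆ n, (W n)ᗮ).topologicalClosure := by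
    rw [← Submodule.orthogonal_orthogonal_eq_closure, ← Submodule.iInf_orthogonal]
    simp_rw [Submodule.orthogonal_orthogonal]
    rw [Submodule.mem_orthogonal]
    intro v hv
    rw [hh, inner_sub_right, hwS' v hv, sub_self]
  have hlim : Tendsto (fun n => (W n)ᗮ.starProjection h) atTop (𝓝 h) := by
    have := Submodule.starProjection_tendsto_closure_iSup (fun n => (W n)ᗮ)
      (fun i j hij => Submodule.orthogonal_le (hanti hij)) h
    rwa [Submodule.starProjection_eq_self_iff.2 hmem] at this
  -- As `w'` lies in every `W n`, the difference `w n - w'` solves the problem on `W n` with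
  -- right-hand side `h`. The part of `h` in `(W n)ᗮ` is invisible there and may be subtracted.
  have hbound : ∀ n, ‖w n - w'‖ ≤ c⁻¹ * ‖h - (W n)ᗮ.starProjection h‖ := by
    intro n
    rw [inv_mul_eq_div, le_div_iff₀' hc]
    refine norm_coercive_solution_le (W := W n) S hS
      ((W n).sub_mem (hw n) ((Submodule.mem_iInf _).1 hw' n)) fun v hv => ?_
    rw [map_sub, inner_sub_right _ (S (w n)), hwS n _ hv, ← inner_sub_right,
      inner_sub_right _ h, (Submodule.mem_orthogonal _ _).1
        ((W n)ᗮ.starProjection_apply_mem h) _ hv, sub_zero]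
  rw [tendsto_iff_norm_sub_tendsto_zero]
  refine squeeze_zero (fun _ => norm_nonneg _) hbound ?_
  have := ((tendsto_const_nhds (x := h)).sub hlim).norm.const_mul c⁻¹
  simpa using this

end Coercive

/-! ### Graphs of bounded elliptic forms on closed subspaces. -/

section FactoredGraph

variable {H : Type*} [NormedAddCommGroup H] [InnerProductSpace ℂ H]
variable {E : Type*} [NormedAddCommGroup E] [InnerProductSpace ℂ E]

/-- The graph in `H` associated with the bounded form `(w, v) ↦ (T w, v)` on a subspace `W` of a
Hilbert space `E` that is mapped into `H` by `J`. -/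
def factoredGraph (J : E →L[ℂ] H) (T : E →L[ℂ] E) (W : Submodule ℂ E) : LinGraph H where
  carrier := {p | ∃ w ∈ W, J w = p.1 ∧ ∀ v ∈ W, inner ℂ v (T w) = inner ℂ (J v) p.2}
  add_mem' := by
    rintro p q ⟨w, hw, hwJ, hwT⟩ ⟨w', hw', hwJ', hwT'⟩
    refine ⟨w + w', W.add_mem hw hw', by simp [hwJ, hwJ'], fun v hv => ?_⟩
    rw [map_add, inner_add_right, hwT v hv, hwT' v hv, Prod.snd_add, inner_add_right]
  zero_mem' := ⟨0, W.zero_mem, by simp, by simp⟩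
  smul_mem' := by
    rintro c p ⟨w, hw, hwJ, hwT⟩
    refine ⟨c • w, W.smul_mem c hw, by simp [hwJ], fun v hv => ?_⟩
    rw [map_smul, inner_smul_right, hwT v hv, Prod.smul_snd, inner_smul_right]

theorem mem_factoredGraph {J : E →L[ℂ] H} {T : E →L[ℂ] E} {W : Submodule ℂ E}
    {x f : H} : (x, f) ∈ factoredGraph J T W ↔
    ∃ w ∈ W, J w = x ∧ ∀ v ∈ W, inner ℂ v (T w) = inner ℂ (J v) f :=
  Iff.rfl

variable [CompleteSpace H] [CompleteSpace E]

/-- The operator representing the form `(T w, v) - z (J w, J v)`. -/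
def shiftedOp (J : E →L[ℂ] H) (T : E →L[ℂ] E) (z : ℂ) : E →L[ℂ] E :=
  T - z • (J.adjoint ∘L J)

theorem inner_shiftedOp (J : E →L[ℂ] H) (T : E →L[ℂ] E) (z : ℂ) (v w : E) :
    inner ℂ v (shiftedOp J T z w) = inner ℂ v (T w) - z * inner ℂ (J v) (J w) := by
  rw [shiftedOp, sub_apply, inner_sub_right, smul_apply,
    inner_smul_right, ContinuousLinearMap.comp_apply, ContinuousLinearMap.adjoint_inner_right]

/-- The form of `T` is nonnegative, and the norm of `E` is controlled by it and by the norm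
of `H`. -/
structure IsElliptic (J : E →L[ℂ] H) (T : E →L[ℂ] E) : Prop where
  re_nonneg : ∀ w, 0 ≤ (inner ℂ w (T w)).re
  norm_sq_le : ∀ w, ‖w‖ ^ 2 ≤ (inner ℂ w (T w)).re + ‖J w‖ ^ 2

variable {J : E →L[ℂ] H} {T : E →L[ℂ] E} {W : Submodule ℂ E}

/-- The real part on the right is `Re (T w, w) + (-Re z) ‖J w‖ ^ 2`. Both terms are nonnegative, so
the smaller of the coefficients `1` and `-Re z` factors out before `norm_sq_le` is applied. -/
theorem IsElliptic.coercive (h : IsElliptic J T) {z : ℂ} (hz : z.re < 0) (w : E) :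
    min 1 (-z.re) * ‖w‖ ^ 2 ≤ (inner ℂ w (shiftedOp J T z w)).re := by
  have e : (inner ℂ w (shiftedOp J T z w)).re = (inner ℂ w (T w)).re + -z.re * ‖J w‖ ^ 2 := by
    have e' : inner ℂ (J w) (J w) = ((‖J w‖ ^ 2 : ℝ) : ℂ) := by
      rw [inner_self_eq_norm_sq_to_K, Complex.ofReal_pow]
      rfl
    rw [inner_shiftedOp, e', Complex.sub_re, Complex.re_mul_ofReal]
    ring
  rw [e]
  have h1 := h.re_nonneg w
  have h2 := h.norm_sq_le w
  have h3 := sq_nonneg ‖J w‖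
  rcases le_total 1 (-z.re) with h4 | h4
  · rw [min_eq_left h4]
    nlinarith
  · rw [min_eq_right h4]
    nlinarith [mul_nonneg (sub_nonneg.2 h4) h1, mul_le_mul_of_nonneg_left h2 (neg_pos.2 hz).le]

omit [CompleteSpace H] in
theorem IsElliptic.adjoint (h : IsElliptic J T) : IsElliptic J T.adjoint := by
  have e : ∀ w, (inner ℂ w (T.adjoint w)).re = (inner ℂ w (T w)).re := by
    intro w
    rw [ContinuousLinearMap.adjoint_inner_right, ← inner_conj_symm, Complex.conj_re]
  exact ⟨fun w => by rw [e]; exact h.re_nonneg w, fun w => by rw [e]; exact h.norm_sq_le w⟩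

theorem inner_shiftedOp_adjoint (z : ℂ) (v w : E) :
    inner ℂ v (shiftedOp J T.adjoint (starRingEnd ℂ z) w) = inner ℂ (shiftedOp J T z v) w := by
  rw [inner_shiftedOp, ← inner_conj_symm (shiftedOp J T z v), inner_shiftedOp, map_sub, map_mul,
    inner_conj_symm, inner_conj_symm, ContinuousLinearMap.adjoint_inner_right]

theorem mem_subScalar_factoredGraph {z : ℂ} {x f : H} :
    (x, f) ∈ (factoredGraph J T W).subScalar z ↔
      ∃ w ∈ W, J w = x ∧ ∀ v ∈ W, inner ℂ v (shiftedOp J T z w) = inner ℂ v (J.adjoint f) := by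
  rw [LinGraph.mem_subScalar, mem_factoredGraph]
  refine exists_congr fun w => and_congr_right fun hw => and_congr_right fun hx =>
    forall₂_congr fun v hv => ?_
  rw [inner_shiftedOp, ContinuousLinearMap.adjoint_inner_right, inner_add_right, inner_smul_right,
    ← hx, sub_eq_iff_eq_add]

theorem IsElliptic.mem_resolventSet (h : IsElliptic J T) (hW : IsClosed (W : Set E)) {z : ℂ}
    (hz : z.re < 0) : z ∈ (factoredGraph J T W).resolventSet := by
  have hc : 0 < min 1 (-z.re) := lt_min one_pos (neg_pos.2 hz)
  refine ⟨fun f => ?_, ?_, ?_⟩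
  · obtain ⟨w, hw, hwS⟩ := exists_coercive_solution hW (shiftedOp J T z) hc (h.coercive hz)
      (J.adjoint f)
    exact ⟨J w, mem_subScalar_factoredGraph.2 ⟨w, hw, rfl, hwS⟩⟩
  · refine IsSeqClosed.isClosed ?_
    rintro p ⟨x, f⟩ hp hlim
    -- For closedness, solve with the limit right-hand side `f`; the a priori estimate then forces
    -- the lifts `u n` to converge in `E`, although only `J (u n)` is known to converge.
    obtain ⟨w, hw, hwS⟩ := exists_coercive_solution hW (shiftedOp J T z) hc (h.coercive hz)
      (J.adjoint f)
    choose u hu huJ huS using fun n => mem_subScalar_factoredGraph.1 (hp n)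
    have hb : ∀ n, ‖u n - w‖ ≤ (min 1 (-z.re))⁻¹ * ‖J.adjoint ((p n).2 - f)‖ := by
      intro n
      rw [inv_mul_eq_div, le_div_iff₀' hc]
      refine norm_coercive_solution_le _ (h.coercive hz) (W.sub_mem (hu n) hw) fun v hv => ?_
      rw [map_sub, inner_sub_right, huS n v hv, hwS v hv, map_sub, inner_sub_right]
    have hf : Tendsto (fun n => (p n).2 - f) atTop (𝓝 0) := by
      simpa using ((continuous_snd.tendsto _).comp hlim).sub_const f
    have huw : Tendsto u atTop (𝓝 w) := by
      rw [tendsto_iff_norm_sub_tendsto_zero]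
      refine squeeze_zero (fun _ => norm_nonneg _) hb ?_
      have := (((J.adjoint.continuous.tendsto 0).comp hf).norm).const_mul (min 1 (-z.re))⁻¹
      simpa using this
    have hx : J w = x := by
      refine tendsto_nhds_unique ((J.continuous.tendsto w).comp huw) ?_
      refine ((continuous_fst.tendsto _).comp hlim).congr fun n => ?_
      exact (huJ n).symm
    exact mem_subScalar_factoredGraph.2 ⟨w, hw, hx, hwS⟩
  · refine Set.eq_singleton_iff_unique_mem.2 ⟨Submodule.zero_mem ((factoredGraph J T W).subScalar z), fun x hx => ?_⟩
    obtain ⟨w, hw, rfl, hwS⟩ := mem_subScalar_factoredGraph.1 hx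
    have := norm_coercive_solution_le _ (h.coercive hz) hw hwS
    rw [map_zero, norm_zero] at this
    have : ‖w‖ ≤ 0 := by nlinarith
    rw [norm_le_zero_iff.1 this, map_zero]

theorem IsElliptic.isMSectorial (h : IsElliptic J T) (hW : IsClosed (W : Set E)) {θ : ℝ}
    (h0 : 0 ≤ θ) (h1 : θ < Real.pi / 2) (hT : ∀ w, inner ℂ w (T w) ∈ sector θ) :
    (factoredGraph J T W).IsMSectorial := by
  refine ⟨0, θ, h0, h1, fun x y hxy => ?_, h.mem_resolventSet hW (by simp)⟩
  rw [LinGraph.mem_subScalar, Complex.ofReal_zero, zero_smul, add_zero] at hxy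
  obtain ⟨w, hw, rfl, hwT⟩ := hxy
  -- The pairing obtained is the conjugate of the one required; the sector is invariant under
  -- conjugation.
  have := hT w
  rw [hwT w hw, mem_sector_iff h0 h1, ← inner_conj_symm, Complex.conj_re, Complex.conj_im,
    abs_neg] at this
  rw [mem_sector_iff h0 h1]
  exact this

/-- Let `y` be orthogonal to the domain, and let `u` solve the adjoint problem at `-1` with datum
`y`, so that `J u` is the adjoint resolvent applied to `y`. Pairing `y` with the resolvent of `J u`
gives `‖J u‖ ^ 2 = 0`; testing the equation of `u` with `u` gives `u = 0`, and then `y` is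
orthogonal to `J '' W`. -/
theorem IsElliptic.image_subset_closure_dom (h : IsElliptic J T) (hW : IsClosed (W : Set E)) :
    J '' W ⊆ closure (factoredGraph J T W).dom := by
  have hc : 0 < min 1 (-(-1 : ℂ).re) := by simp
  have hz : (starRingEnd ℂ (-1)).re < 0 := by simp
  let D : Submodule ℂ H := (factoredGraph J T W).map (LinearMap.fst ℂ H H)
  have hD : (D : Set H) = (factoredGraph J T W).dom := by
    ext x
    simp [D, LinGraph.dom]
  rw [← hD, ← Submodule.topologicalClosure_coe, ← Submodule.orthogonal_orthogonal_eq_closure]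
  rintro _ ⟨v, hv, rfl⟩
  refine (Submodule.mem_orthogonal _ _).2 fun y hy => ?_
  obtain ⟨u, hu, huS⟩ := exists_coercive_solution hW
    (shiftedOp J T.adjoint (starRingEnd ℂ (-1))) (lt_min one_pos (neg_pos.2 hz))
    (h.adjoint.coercive hz) (J.adjoint y)
  obtain ⟨w, hw, hwS⟩ := exists_coercive_solution hW (shiftedOp J T (-1)) hc (h.coercive (by simp))
    (J.adjoint (J u))
  have hwD : J w ∈ D := by
    have := (LinGraph.mem_subScalar _ _ _ _).1
      (mem_subScalar_factoredGraph.2 ⟨w, hw, rfl, hwS⟩)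
    exact ⟨_, this, rfl⟩
  have e : inner ℂ (J u) (J u) = inner ℂ (J w) y := by
    rw [← ContinuousLinearMap.adjoint_inner_right J w y, ← huS w hw, inner_shiftedOp_adjoint,
      ← inner_conj_symm (shiftedOp J T (-1) w), hwS u hu, inner_conj_symm, ContinuousLinearMap.adjoint_inner_left]
  rw [(Submodule.mem_orthogonal _ _).1 hy _ hwD, inner_self_eq_zero] at e
  have hu0 : u = 0 := by
    have h2 := huS u hu
    rw [ContinuousLinearMap.adjoint_inner_right, e, inner_zero_left] at h2
    have h3 := h.adjoint.coercive (z := starRingEnd ℂ (-1)) hz u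
    rw [h2] at h3
    simpa using h3
  have h4 := huS v hv
  rw [hu0, map_zero, inner_zero_right, ContinuousLinearMap.adjoint_inner_right] at h4
  rw [← inner_conj_symm, ← h4, map_zero]

-- If `w` lifts `0`, then `(T w, w) = 0` and `J w = 0`, so ellipticity kills `w`; the remaining
-- equation says that `y` is orthogonal to `J '' W`.
omit [CompleteSpace H] [CompleteSpace E] in
theorem IsElliptic.isSingleValued (h : IsElliptic J T)
    (hd : Dense (J '' W)) : (factoredGraph J T W).IsSingleValued := by
  refine Set.eq_singleton_iff_unique_mem.2 ⟨Submodule.zero_mem (factoredGraph J T W), fun y hy => ?_⟩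
  obtain ⟨w, hw, hwJ, hwT⟩ := mem_factoredGraph.1 hy
  have hw0 : w = 0 := by
    have := h.norm_sq_le w
    rw [hwT w hw, hwJ] at this
    simpa using this
  refine hd.eq_zero_of_inner_left ℂ ?_
  rintro _ ⟨v, hv, rfl⟩
  have := hwT v hv
  rw [hw0, map_zero, inner_zero_right] at this
  rw [← inner_conj_symm, ← this, map_zero]

/-- Weak closedness of `factoredGraph`, tested on a dense subspace. -/
theorem IsElliptic.mem_factoredGraph_of_tendsto (h : IsElliptic J T) {W₀ : Submodule ℂ E}
    {u : ℕ → E} (hu : ∀ n, u n ∈ W₀.topologicalClosure) {C : ℝ} (hC : ∀ n, ‖u n‖ ≤ C) {x f : H}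
    (hx : Tendsto (fun n => J (u n)) atTop (𝓝 x))
    (hf : ∀ v ∈ W₀, Tendsto (fun n => inner ℂ v (T (u n))) atTop (𝓝 (inner ℂ (J v) f))) :
    (x, f) ∈ factoredGraph J T W₀.topologicalClosure := by
  have hc : 0 < min 1 (-(-1 : ℂ).re) := by simp
  have hz : (starRingEnd ℂ (-1)).re < 0 := by simp
  have hW : IsClosed (W₀.topologicalClosure : Set E) := W₀.isClosed_topologicalClosure
  set S := shiftedOp J T (-1) with hSdef
  -- The candidate lift of `x`: the resolvent at `-1` must send `f + x` to `x`. Weak compactness is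
  -- avoided by comparing `u n` with this `w`.
  obtain ⟨w, hw, hwS⟩ := exists_coercive_solution hW S hc (h.coercive (by simp)) (J.adjoint (f + x))
  have hdense : ∀ v ∈ W₀, Tendsto (fun n => inner ℂ v (S (u n - w))) atTop (𝓝 0) := by
    intro v hv
    have e : ∀ n, inner ℂ v (S (u n - w)) =
        (inner ℂ v (T (u n)) + inner ℂ (J v) (J (u n))) - inner ℂ (J v) (f + x) := by
      intro n
      rw [map_sub, inner_sub_right, hwS v (W₀.le_topologicalClosure hv), hSdef, inner_shiftedOp,
        ContinuousLinearMap.adjoint_inner_right]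
      ring
    have := ((hf v hv).add ((tendsto_const_nhds (x := J v)).inner hx (𝕜 := ℂ))).sub_const
      (inner ℂ (J v) (f + x))
    rw [← inner_add_right, sub_self] at this
    exact this.congr fun n => (e n).symm
  have hall : ∀ v ∈ W₀.topologicalClosure,
      Tendsto (fun n => inner ℂ v (S (u n - w))) atTop (𝓝 0) := by
    intro v hv
    set M := ‖S‖ * (C + ‖w‖) + 1 with hM
    have hCnn : 0 ≤ C := (norm_nonneg _).trans (hC 0)
    have hMpos : 0 < M := by positivity
    have hSb : ∀ n, ‖S (u n - w)‖ ≤ M := by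
      intro n
      have h1 := S.le_opNorm (u n - w)
      have h2 : ‖u n - w‖ ≤ C + ‖w‖ := (norm_sub_le _ _).trans (by gcongr; exact hC n)
      have h3 := mul_le_mul_of_nonneg_left h2 (norm_nonneg S)
      linarith
    rw [Metric.tendsto_atTop]
    intro ε hε
    obtain ⟨v', hv', hvv'⟩ := Metric.mem_closure_iff.1 hv (ε / (2 * M)) (by positivity)
    obtain ⟨N, hN⟩ := Metric.tendsto_atTop.1 (hdense v' hv') (ε / 2) (by positivity)
    refine ⟨N, fun n hn => ?_⟩
    have h1 := hN n hn
    rw [dist_zero_right] at h1 ⊢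
    rw [dist_eq_norm] at hvv'
    have e : inner ℂ v (S (u n - w)) =
        inner ℂ (v - v') (S (u n - w)) + inner ℂ v' (S (u n - w)) := by
      rw [← inner_add_left, sub_add_cancel]
    have h2 : ‖inner ℂ (v - v') (S (u n - w))‖ ≤ ε / 2 := by
      calc _ ≤ ‖v - v'‖ * ‖S (u n - w)‖ := norm_inner_le_norm _ _
        _ ≤ ε / (2 * M) * M := by gcongr; exact hSb n
        _ = ε / 2 := by field_simp
    rw [e]
    exact (norm_add_le _ _).trans_lt (by linarith)
  -- Testing with the adjoint solution `v` for the datum `J w - x` turns the weak limit `0` into the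
  -- limit `-‖J w - x‖ ^ 2`.
  have hJw : J w = x := by
    rw [← sub_eq_zero, ← inner_self_eq_zero (𝕜 := ℂ)]
    obtain ⟨v, hv, hvS⟩ := exists_coercive_solution hW
      (shiftedOp J T.adjoint (starRingEnd ℂ (-1))) (lt_min one_pos (neg_pos.2 hz))
      (h.adjoint.coercive hz) (J.adjoint (J w - x))
    have e : ∀ n, inner ℂ v (S (u n - w)) = inner ℂ (J w - x) (J (u n) - J w) := by
      intro n
      have h1 := hvS (u n - w) (W₀.topologicalClosure.sub_mem (hu n) hw)
      rw [inner_shiftedOp_adjoint, ContinuousLinearMap.adjoint_inner_right, map_sub J] at h1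
      rw [← inner_conj_symm, h1, inner_conj_symm]
    have h2 : Tendsto (fun n => inner ℂ v (S (u n - w))) atTop
        (𝓝 (inner ℂ (J w - x) (x - J w))) := by
      simp_rw [e]
      exact tendsto_const_nhds.inner (hx.sub_const _)
    have h3 := tendsto_nhds_unique h2 (hall v hv)
    rw [← neg_sub (J w) x, inner_neg_right, neg_eq_zero] at h3
    exact h3
  have := (LinGraph.mem_subScalar _ _ _ _).1
    (mem_subScalar_factoredGraph.2 ⟨w, hw, hJw, hwS⟩)
  simpa using this

/-- Strong resolvent convergence along a decreasing sequence of closed subspaces. -/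
theorem IsElliptic.strongResolventTendsto (h : IsElliptic J T) {W : ℕ → Submodule ℂ E}
    (hW : ∀ n, IsClosed (W n : Set E)) (hanti : Antitone W) :
    LinGraph.StrongResolventTendsto (fun n => factoredGraph J T (W n))
      (factoredGraph J T (⨅ n, W n)) := by
  intro z hz
  have hinf : IsClosed ((⨅ n, W n : Submodule ℂ E) : Set E) := by
    rw [Submodule.coe_iInf]
    exact isClosed_iInter hW
  refine ⟨fun n => h.mem_resolventSet (hW n) hz, h.mem_resolventSet hinf hz, ?_⟩
  intro f x y hx hy
  choose w hw hwJ hwS using fun n => mem_subScalar_factoredGraph.1 (hx n)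
  obtain ⟨w', hw', rfl, hwS'⟩ := mem_subScalar_factoredGraph.1 hy
  have := tendsto_coercive_solution hW hanti (shiftedOp J T z)
    (lt_min one_pos (neg_pos.2 hz)) (h.coercive hz) hw hwS hw' hwS'
  exact ((J.continuous.tendsto w').comp this).congr hwJ

end FactoredGraph

/-! ### Uniqueness of the strong resolvent limit. -/

section Uniqueness

variable {H : Type*} [NormedAddCommGroup H] [InnerProductSpace ℂ H]

/-- A graph is determined by its resolvent at the single point `-1`, and that is a limit in the
Hausdorff space `H`. -/
theorem LinGraph.StrongResolventTendsto.le {A : ℕ → LinGraph H} {B B' : LinGraph H}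
    (hB : LinGraph.StrongResolventTendsto A B) (hB' : LinGraph.StrongResolventTendsto A B') :
    B ≤ B' := by
  rintro ⟨x, y⟩ hxy
  obtain ⟨hres, -, hlim⟩ := hB (-1) (by simp)
  obtain ⟨-, hres', hlim'⟩ := hB' (-1) (by simp)
  have hx : (x, y + x) ∈ B.subScalar (-1) := by
    rw [LinGraph.mem_subScalar]
    simpa using hxy
  choose u hu using fun n => (hres n).1 (y + x)
  obtain ⟨x', hx'⟩ := hres'.1 (y + x)
  obtain rfl := tendsto_nhds_unique (hlim _ _ _ hu hx) (hlim' _ _ _ hu hx')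
  rw [LinGraph.mem_subScalar] at hx'
  simpa using hx'

theorem LinGraph.StrongResolventTendsto.unique {A : ℕ → LinGraph H} {B B' : LinGraph H}
    (hB : LinGraph.StrongResolventTendsto A B) (hB' : LinGraph.StrongResolventTendsto A B') :
    B = B' :=
  le_antisymm (hB.le hB') (hB'.le hB)

end Uniqueness

/-! ### Energy spaces and bounded representation of forms. -/

section EnergySpace

universe u

variable {V : Type u} [AddCommGroup V] [Module ℂ V] (b : V →ₗ[ℂ] V →ₗ⋆[ℂ] ℂ)

/-- The semi-inner product given by the symmetric part of an accretive form. -/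
@[reducible]
def reInnerCore (hb : ∀ u, 0 ≤ (b u u).re) : PreInnerProductSpace.Core ℂ V where
  inner v u := (b u v + starRingEnd ℂ (b v u)) / 2
  conj_inner_symm x y := by
    rw [map_div₀, map_add, Complex.conj_conj, map_ofNat, add_comm]
  re_inner_nonneg x := by
    have : (b x x + starRingEnd ℂ (b x x)) / 2 = ((b x x).re : ℂ) := by
      rw [Complex.add_conj]
      simp
    simpa [this] using hb x
  add_left x y z := by
    simp only [map_add, LinearMap.add_apply]
    ring
  smul_left x y r := by
    simp only [map_smul, LinearMap.map_smulₛₗ, LinearMap.smul_apply, smul_eq_mul, map_mul]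
    ring

/-- The completion of the domain of an accretive form with respect to its symmetric part. -/
theorem exists_energySpace (hb : ∀ u, 0 ≤ (b u u).re) :
    ∃ (K : Type u) (_ : NormedAddCommGroup K) (_ : InnerProductSpace ℂ K) (_ : CompleteSpace K)
      (q : V →ₗ[ℂ] K), DenseRange q ∧ ∀ u, ‖q u‖ ^ 2 = (b u u).re := by
  let c := reInnerCore b hb
  let : SeminormedAddCommGroup V := InnerProductSpace.Core.toSeminormedAddCommGroup (c := c)
  let : InnerProductSpace ℂ V := InnerProductSpace.ofCore c
  refine ⟨UniformSpace.Completion V, inferInstance, inferInstance, inferInstance,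
    (UniformSpace.Completion.toComplL (𝕜 := ℂ) (E := V)).toLinearMap,
    UniformSpace.Completion.denseRange_coe, fun u => ?_⟩
  have h1 : ‖(u : UniformSpace.Completion V)‖ = ‖u‖ := UniformSpace.Completion.norm_coe u
  have h2 : ‖u‖ ^ 2 = RCLike.re (inner ℂ u u) := InnerProductSpace.norm_sq_eq_re_inner u
  have h3 : inner ℂ u u = ((b u u).re : ℂ) := by
    change (b u u + starRingEnd ℂ (b u u)) / 2 = _
    rw [Complex.add_conj]
    simp
  change ‖(u : UniformSpace.Completion V)‖ ^ 2 = _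
  rw [h1, h2, h3]
  simp

theorem sesquilinear_polarization (u v : V) :
    4 * b u v = b (u + v) (u + v) - b (u - v) (u - v) +
      Complex.I * b (u + Complex.I • v) (u + Complex.I • v) -
      Complex.I * b (u - Complex.I • v) (u - Complex.I • v) := by
  simp only [map_add, map_sub, LinearMap.add_apply, LinearMap.sub_apply, map_smul,
    LinearMap.map_smulₛₗ, LinearMap.smul_apply, smul_eq_mul, Complex.conj_I]
  ring_nf
  simp only [Complex.I_sq]
  ring

variable {b} {K : Type*} [NormedAddCommGroup K] [InnerProductSpace ℂ K]

/-- A form whose quadratic values are bounded by a Hilbert seminorm is bounded. -/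
theorem norm_form_le {q : V →ₗ[ℂ] K} {M : ℝ} (hM : 0 ≤ M)
    (hb : ∀ u, ‖b u u‖ ≤ M * ‖q u‖ ^ 2) (u v : V) : ‖b u v‖ ≤ 2 * M * ‖q u‖ * ‖q v‖ := by
  have h1 : ∀ u v, ‖b u v‖ ≤ M * (‖q u‖ ^ 2 + ‖q v‖ ^ 2) := by
    intro u v
    have p1 := parallelogram_law_with_norm ℂ (q u) (q v)
    have p2 := parallelogram_law_with_norm ℂ (q u) (Complex.I • q v)
    rw [norm_smul, Complex.norm_I, one_mul] at p2
    have n1 := hb (u + v)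
    have n2 := hb (u - v)
    have n3 := hb (u + Complex.I • v)
    have n4 := hb (u - Complex.I • v)
    rw [map_add q] at n1 n3
    rw [map_sub q] at n2 n4
    rw [map_smul q] at n3 n4
    have e : 4 * ‖b u v‖ ≤ ‖b (u + v) (u + v)‖ + ‖b (u - v) (u - v)‖ +
        ‖b (u + Complex.I • v) (u + Complex.I • v)‖ +
        ‖b (u - Complex.I • v) (u - Complex.I • v)‖ := by
      have h4 : 4 * ‖b u v‖ = ‖4 * b u v‖ := by simp
      rw [h4, sesquilinear_polarization]
      refine (norm_sub_le _ _).trans ?_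
      refine add_le_add ((norm_add_le _ _).trans (add_le_add (norm_sub_le _ _) ?_)) ?_ <;> simp
    have m1 := congrArg (M * ·) p1
    have m2 := congrArg (M * ·) p2
    simp only [mul_add] at m1 m2
    linarith
  -- Scaling `u` by `s⁻¹` and `v` by `t⁻¹` turns the sum of squares in `h1` into a product. Strictly
  -- positive `s`, `t` cover the case `q u = 0` or `q v = 0`, through `‖q u‖ + ε` and `ε → 0`.
  have h2 : ∀ s t : ℝ, 0 < s → 0 < t → ‖q u‖ ≤ s → ‖q v‖ ≤ t → ‖b u v‖ ≤ 2 * M * s * t := by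
    intro s t hs ht hus hvt
    have := h1 (((s⁻¹ : ℝ) : ℂ) • u) (((t⁻¹ : ℝ) : ℂ) • v)
    simp only [map_smul, LinearMap.map_smulₛₗ, LinearMap.smul_apply, smul_eq_mul, norm_mul,
      norm_smul, Complex.conj_ofReal, Complex.norm_real, norm_inv, Real.norm_eq_abs, abs_of_pos hs,
      abs_of_pos ht] at this
    have e1 : s⁻¹ * ‖q u‖ ≤ 1 := by rwa [inv_mul_le_iff₀ hs, mul_one]
    have e2 : t⁻¹ * ‖q v‖ ≤ 1 := by rwa [inv_mul_le_iff₀ ht, mul_one]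
    have e3 : (s⁻¹ * ‖q u‖) ^ 2 ≤ 1 := pow_le_one₀ (by positivity) e1
    have e4 : (t⁻¹ * ‖q v‖) ^ 2 ≤ 1 := pow_le_one₀ (by positivity) e2
    have e5 : t⁻¹ * (s⁻¹ * ‖b u v‖) ≤ M * (1 + 1) :=
      (le_of_eq (by ring)).trans (this.trans (by gcongr))
    rw [inv_mul_le_iff₀ ht, inv_mul_le_iff₀ hs] at e5
    linarith
  have hlim : Tendsto (fun ε : ℝ => 2 * M * (‖q u‖ + ε) * (‖q v‖ + ε)) (𝓝[>] 0)
      (𝓝 (2 * M * ‖q u‖ * ‖q v‖)) := by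
    have : ContinuousAt (fun ε : ℝ => 2 * M * (‖q u‖ + ε) * (‖q v‖ + ε)) 0 := by fun_prop
    have := this.tendsto.mono_left (nhdsWithin_le_nhds (s := Set.Ioi 0))
    simpa using this
  refine ge_of_tendsto hlim ?_
  filter_upwards [self_mem_nhdsWithin] with ε hε
  have hε : 0 < ε := hε
  exact h2 _ _ (by positivity) (by positivity) (by linarith) (by linarith)

/-- A bounded form is represented by a bounded operator. -/
theorem exists_representing_operator [CompleteSpace K] {q : V →ₗ[ℂ] K} (hq : DenseRange q)
    {C : ℝ} (hC : 0 ≤ C) (hb : ∀ u v, ‖b u v‖ ≤ C * ‖q u‖ * ‖q v‖) :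
    ∃ T : K →L[ℂ] K, ‖T‖ ≤ C ∧ ∀ u v, inner ℂ (q v) (T (q u)) = b u v := by
  -- Conjugation makes the functional linear in `v`, so that it extends to `K` and Riesz
  -- representation applies.
  let F : V → V →ₗ[ℂ] ℂ := fun u =>
    { toFun := fun v => starRingEnd ℂ (b u v)
      map_add' := by simp
      map_smul' := by simp }
  have hF : ∀ u v, ‖F u v‖ ≤ (C * ‖q u‖) * ‖q v‖ := fun u v => by
    change ‖starRingEnd ℂ (b u v)‖ ≤ _
    rw [RCLike.norm_conj]
    exact hb u v
  let t : V → K := fun u => (InnerProductSpace.toDual ℂ K).symm ((F u).extendOfNorm q)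
  have ht : ∀ u v, inner ℂ (q v) (t u) = b u v := by
    intro u v
    rw [← inner_conj_symm, InnerProductSpace.toDual_symm_apply,
      LinearMap.extendOfNorm_eq hq ⟨_, hF u⟩]
    exact Complex.conj_conj _
  let t' : V →ₗ[ℂ] K :=
    { toFun := t
      map_add' := fun u u' => by
        refine hq.eq_of_inner_right ℂ fun v => ?_
        rw [inner_add_right, ht, ht, ht, map_add, LinearMap.add_apply]
      map_smul' := fun c u => by
        refine hq.eq_of_inner_right ℂ fun v => ?_
        rw [RingHom.id_apply, inner_smul_right, ht, ht, map_smul, LinearMap.smul_apply,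
          smul_eq_mul] }
  have hbound : ∀ u, ‖t' u‖ ≤ C * ‖q u‖ := fun u => by
    change ‖(InnerProductSpace.toDual ℂ K).symm ((F u).extendOfNorm q)‖ ≤ _
    rw [LinearIsometryEquiv.norm_map]
    exact LinearMap.opNorm_extendOfNorm_le hq (by positivity) (hF u)
  refine ⟨t'.extendOfNorm q, LinearMap.opNorm_extendOfNorm_le hq hC hbound, fun u v => ?_⟩
  rw [LinearMap.extendOfNorm_eq hq ⟨C, hbound⟩]
  exact ht u v

end EnergySpace

/-! ### Representation of a single sectorial form. -/

section

universe u

variable {H : Type u} [NormedAddCommGroup H] [InnerProductSpace ℂ H]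

theorem SesqForm.IsSectorialWith.re_im {a : SesqForm H} {θ : ℝ} (h : a.IsSectorialWith 0 θ)
    (u : a.dom) : 0 ≤ (a.form u u).re ∧ |(a.form u u).im| ≤ Real.tan θ * (a.form u u).re := by
  simpa using (mem_sector_iff h.1 h.2.1 _).1 (h.2.2 u)

/-- A sectorial form with vertex `0` is represented by a bounded operator on a Hilbert space,
with the norm of the space given by the real part of the form. -/
theorem SesqForm.IsSectorialWith.exists_representation {a : SesqForm H} {θ : ℝ}
    (h : a.IsSectorialWith 0 θ) :
    ∃ (K : Type u) (_ : NormedAddCommGroup K) (_ : InnerProductSpace ℂ K) (_ : CompleteSpace K)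
      (q : a.dom →ₗ[ℂ] K) (T : K →L[ℂ] K), ‖T‖ ≤ 2 * (1 + Real.tan θ) ∧
      (∀ u v, inner ℂ (q v) (T (q u)) = a.form u v) ∧
      (∀ w, (inner ℂ w (T w)).re = ‖w‖ ^ 2 ∧ |(inner ℂ w (T w)).im| ≤ Real.tan θ * ‖w‖ ^ 2) := by
  have ht : 0 ≤ Real.tan θ := Real.tan_nonneg_of_nonneg_of_le_pi_div_two h.1 h.2.1.le
  obtain ⟨K, i1, i2, i3, q, hq, hqn⟩ := exists_energySpace a.form fun u => (h.re_im u).1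
  -- Sectoriality bounds the whole form by its real part, with a constant depending only on `θ`.
  have hb : ∀ u, ‖a.form u u‖ ≤ (1 + Real.tan θ) * ‖q u‖ ^ 2 := fun u => by
    have := h.re_im u
    refine (Complex.norm_le_abs_re_add_abs_im _).trans ?_
    rw [abs_of_nonneg this.1, hqn]
    linarith [this.2]
  obtain ⟨T, hT, hTq⟩ := exists_representing_operator hq (by positivity)
    (norm_form_le (by positivity) hb)
  refine ⟨K, i1, i2, i3, q, T, hT, hTq, fun w => ⟨?_, ?_⟩⟩
  · refine hq.induction_on (p := fun w => (inner ℂ w (T w)).re = ‖w‖ ^ 2) w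
      (isClosed_eq (by fun_prop) (by fun_prop)) fun u => ?_
    rw [hTq, hqn]
  · refine hq.induction_on (p := fun w => |(inner ℂ w (T w)).im| ≤ Real.tan θ * ‖w‖ ^ 2) w
      (isClosed_le (by fun_prop) (by fun_prop)) fun u => ?_
    rw [hTq, hqn]
    exact (h.re_im u).2

end

/-! ### The Hilbert sum and the graphs of the partial sums. -/

section HilbertSum

variable {H : Type*} [NormedAddCommGroup H] [InnerProductSpace ℂ H]
variable {K : ℕ → Type*} [∀ n, NormedAddCommGroup (K n)] [∀ n, InnerProductSpace ℂ (K n)]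

/-- The operator `(x, (wₖ)ₖ) ↦ (0, (Tₖ wₖ)ₖ)` on the Hilbert sum. -/
def sumOp (H : Type*) [NormedAddCommGroup H] [InnerProductSpace ℂ H]
    (T : ∀ n, K n →L[ℂ] K n) {M : ℝ} (hM : 0 ≤ M) (hT : ∀ n, ‖T n‖ ≤ M) :
    WithLp 2 (H × lp K 2) →L[ℂ] WithLp 2 (H × lp K 2) :=
  (WithLp.prodContinuousLinearEquiv 2 ℂ H (lp K 2)).symm.toContinuousLinearMap ∘L
    ContinuousLinearMap.inr ℂ H (lp K 2) ∘L lp.mapCLM 2 T hM hT ∘L WithLp.sndL 2 ℂ H (lp K 2)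

variable {T : ∀ n, K n →L[ℂ] K n} {M : ℝ} (hM : 0 ≤ M) (hT : ∀ n, ‖T n‖ ≤ M)

theorem hasSum_inner_sumOp (v w : WithLp 2 (H × lp K 2)) :
    HasSum (fun k => inner ℂ (v.snd k) (T k (w.snd k))) (inner ℂ v (sumOp H T hM hT w)) := by
  have h := lp.hasSum_inner v.snd (lp.mapCLM 2 T hM hT w.snd) (𝕜 := ℂ)
  have e : inner ℂ v (sumOp H T hM hT w) = inner ℂ v.snd (lp.mapCLM 2 T hM hT w.snd) := by
    rw [WithLp.prod_inner_apply]
    change inner ℂ v.fst (0 : H) + _ = _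
    rw [inner_zero_right, zero_add]
    rfl
  rw [e]
  exact h

omit [∀ n, InnerProductSpace ℂ (K n)] in
theorem hasSum_norm_sq (f : lp K 2) : HasSum (fun k => ‖f k‖ ^ 2) (‖f‖ ^ 2) := by
  have := lp.hasSum_norm (p := 2) (by simp) f
  simpa using this

theorem re_inner_sumOp (h : ∀ k w, (inner ℂ w (T k w)).re = ‖w‖ ^ 2)
    (w : WithLp 2 (H × lp K 2)) : (inner ℂ w (sumOp H T hM hT w)).re = ‖w.snd‖ ^ 2 := by
  refine (Complex.hasSum_re (hasSum_inner_sumOp hM hT w w)).unique ?_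
  simp_rw [h]
  exact hasSum_norm_sq _

theorem isElliptic_sumOp (h : ∀ k w, (inner ℂ w (T k w)).re = ‖w‖ ^ 2) :
    IsElliptic (WithLp.fstL 2 ℂ H (lp K 2)) (sumOp H T hM hT) := by
  refine ⟨fun w => ?_, fun w => ?_⟩
  · rw [re_inner_sumOp hM hT h]
    positivity
  · rw [re_inner_sumOp hM hT h, WithLp.prod_norm_sq_eq_of_L2, add_comm]
    rfl

theorem inner_sumOp_mem_sector {θ : ℝ} (h0 : 0 ≤ θ) (h1 : θ < Real.pi / 2)
    (h : ∀ k w, (inner ℂ w (T k w)).re = ‖w‖ ^ 2)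
    (h' : ∀ k w, |(inner ℂ w (T k w)).im| ≤ Real.tan θ * ‖w‖ ^ 2)
    (w : WithLp 2 (H × lp K 2)) : inner ℂ w (sumOp H T hM hT w) ∈ sector θ := by
  rw [mem_sector_iff h0 h1, re_inner_sumOp hM hT h]
  refine ⟨by positivity, ?_⟩
  have hs := Complex.hasSum_im (hasSum_inner_sumOp hM hT w w)
  have hn := (hasSum_norm_sq w.snd).mul_left (Real.tan θ)
  rw [abs_le]
  exact ⟨hasSum_le (fun k => (abs_le.1 (h' k _)).1) hn.neg hs,
    hasSum_le (fun k => (abs_le.1 (h' k _)).2) hs hn⟩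

/-- The elements of the Hilbert sum whose components up to `n` come from a common vector of `H`;
the later components are free. -/
def tailFreeSpace (b : ℕ → SesqForm H) (q : ∀ n, (b n).dom →ₗ[ℂ] K n) (n : ℕ) :
    Submodule ℂ (WithLp 2 (H × lp K 2)) where
  carrier := {w | ∀ k ≤ n, ∃ h : w.fst ∈ (b k).dom, w.snd k = q k ⟨w.fst, h⟩}
  add_mem' := by
    intro v w hv hw k hk
    obtain ⟨h1, e1⟩ := hv k hk
    obtain ⟨h2, e2⟩ := hw k hk
    refine ⟨(b k).dom.add_mem h1 h2, ?_⟩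
    change v.snd k + w.snd k = _
    rw [e1, e2, ← map_add]
    rfl
  zero_mem' := fun k _ => ⟨(b k).dom.zero_mem, ((q k).map_zero).symm⟩
  smul_mem' := by
    intro c w hw k hk
    obtain ⟨h1, e1⟩ := hw k hk
    refine ⟨(b k).dom.smul_mem c h1, ?_⟩
    change c • w.snd k = _
    rw [e1, ← map_smul]
    rfl

variable {b : ℕ → SesqForm H} {q : ∀ n, (b n).dom →ₗ[ℂ] K n}

theorem antitone_tailFreeSpace : Antitone (tailFreeSpace b q) :=
  fun _ _ hmn _ hw k hk => hw k (hk.trans hmn)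

theorem fst_mem_dom_partialSum {n : ℕ} {w : WithLp 2 (H × lp K 2)}
    (hw : w ∈ tailFreeSpace b q n) : w.fst ∈ (SesqForm.partialSum b n).dom :=
  (Submodule.mem_iInf _).2 fun k => (hw k (Nat.lt_succ_iff.1 k.2)).1

/-- The operator is diagonal, so a zero tail in just one of the two vectors removes all terms with
`k > n`. -/
theorem inner_sumOp_eq_partialSum (hq : ∀ k u v, inner ℂ (q k v) (T k (q k u)) = (b k).form u v)
    {n : ℕ} {v w : WithLp 2 (H × lp K 2)} (hv : v ∈ tailFreeSpace b q n)
    (hw : w ∈ tailFreeSpace b q n) (h0 : ∀ k, n < k → v.snd k = 0 ∨ w.snd k = 0) :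
    inner ℂ v (sumOp H T hM hT w) = (SesqForm.partialSum b n).form
      ⟨w.fst, fst_mem_dom_partialSum hw⟩ ⟨v.fst, fst_mem_dom_partialSum hv⟩ := by
  refine (hasSum_inner_sumOp hM hT v w).unique ?_
  rw [SesqForm.partialSum_form_apply]
  have e : ∀ k : Fin (n + 1), (b k).form
      ⟨w.fst, (Submodule.mem_iInf _).1 (fst_mem_dom_partialSum hw) k⟩
      ⟨v.fst, (Submodule.mem_iInf _).1 (fst_mem_dom_partialSum hv) k⟩ =
      inner ℂ (v.snd k) (T k (w.snd k)) := by
    intro k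
    obtain ⟨h1, e1⟩ := hv k (Nat.lt_succ_iff.1 k.2)
    obtain ⟨h2, e2⟩ := hw k (Nat.lt_succ_iff.1 k.2)
    rw [e1, e2, hq]
  rw [Finset.sum_congr rfl fun k _ => e k,
    ← Finset.sum_range fun k => inner ℂ (v.snd k) (T k (w.snd k))]
  refine hasSum_sum_of_ne_finset_zero fun k hk => ?_
  rw [Finset.mem_range, not_lt] at hk
  rcases h0 k hk with h | h <;> simp [h]

/-- Every vector in the domain of the partial sum lifts to an element with zero tail. -/
theorem exists_lift {n : ℕ} {u : H} (hu : u ∈ (SesqForm.partialSum b n).dom) :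
    ∃ w ∈ tailFreeSpace b q n, w.fst = u ∧ ∀ k, n < k → w.snd k = 0 := by
  classical
  have hu' : ∀ k ≤ n, u ∈ (b k).dom := fun k hk =>
    (Submodule.mem_iInf _).1 hu (⟨k, Nat.lt_succ_iff.2 hk⟩ : Fin (n + 1))
  let f : ∀ k, K k := fun k => if h : k ≤ n then q k ⟨u, hu' k h⟩ else 0
  have hf : Memℓp f 2 := by
    refine memℓp_gen (summable_of_ne_finset_zero (s := Finset.range (n + 1)) fun k hk => ?_)
    have : ¬ k ≤ n := fun h => hk (Finset.mem_range.2 (Nat.lt_succ_iff.2 h))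
    simp [f, this]
  refine ⟨WithLp.toLp 2 (u, ⟨f, hf⟩), fun k hk => ⟨hu' k hk, ?_⟩, rfl, fun k hk => ?_⟩
  · exact dif_pos hk
  · exact dif_neg (not_le.2 hk)

/-- Every vector in the limit domain lifts to an element of all the `tailFreeSpace`s. -/
theorem exists_lift_of_mem_limitDomain (hq : ∀ k u, ‖q k u‖ ^ 2 = ((b k).form u u).re) {u : H}
    (hu : u ∈ SesqForm.limitDomain b) :
    ∃ w : WithLp 2 (H × lp K 2), (∀ n, w ∈ tailFreeSpace b q n) ∧ w.fst = u := by
  obtain ⟨h, hs⟩ := hu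
  have hf : Memℓp (fun k => q k ⟨u, h k⟩) 2 := by
    refine memℓp_gen ?_
    simpa [hq] using hs
  exact ⟨WithLp.toLp 2 (u, ⟨_, hf⟩), fun n k _ => ⟨h k, rfl⟩, rfl⟩

variable [CompleteSpace H] [∀ n, CompleteSpace (K n)]

/-- Forwards, approximants lift with zero tail and stay bounded in `E`, so weak closedness applies.
Backwards, the first components of a sequence in `tailFreeSpace` converging to `w` are the
approximants; testing only with zero-tail lifts makes the free tail harmless. -/
theorem memGraph_partialSum_iff
    (hq : ∀ k u v, inner ℂ (q k v) (T k (q k u)) = (b k).form u v)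
    (h : ∀ k w, (inner ℂ w (T k w)).re = ‖w‖ ^ 2) (n : ℕ) (p : H × H) :
    (SesqForm.partialSum b n).MemGraph p ↔
      p ∈ factoredGraph (WithLp.fstL 2 ℂ H (lp K 2)) (sumOp H T hM hT)
        (tailFreeSpace b q n).topologicalClosure := by
  obtain ⟨x, f⟩ := p
  constructor
  · rintro ⟨u, hux, hub, huf⟩
    obtain ⟨C, hC⟩ := hub.exists_norm_le
    obtain ⟨D, hD⟩ := (Metric.isBounded_range_of_tendsto _ hux).exists_norm_le
    choose w hw hwu hwt using fun m => exists_lift (q := q) (u m).2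
    have hell := isElliptic_sumOp (H := H) hM hT h
    -- Ellipticity gives `‖w m‖ ^ 2 ≤ C + D ^ 2`, and `t ≤ t ^ 2 + 1`.
    refine hell.mem_factoredGraph_of_tendsto (u := w) (C := C + D ^ 2 + 1)
      (fun m => (tailFreeSpace b q n).le_topologicalClosure (hw m)) (fun m => ?_) ?_ ?_
    · have h1 := hell.norm_sq_le (w m)
      have e : (⟨(w m).fst, fst_mem_dom_partialSum (hw m)⟩ : (SesqForm.partialSum b n).dom) = u m :=
        Subtype.ext (hwu m)
      rw [inner_sumOp_eq_partialSum hM hT hq (hw m) (hw m) fun k hk => Or.inl (hwt m k hk),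
        e] at h1
      have h2 : ‖(SesqForm.partialSum b n).form (u m) (u m)‖ ≤ C := hC _ ⟨m, rfl⟩
      have h3 : ‖WithLp.fstL 2 ℂ H (lp K 2) (w m)‖ ≤ D := by
        change ‖(w m).fst‖ ≤ D
        rw [hwu m]
        exact hD _ ⟨m, rfl⟩
      have h4 := pow_le_pow_left₀ (norm_nonneg _) h3 2
      have h5 := (Complex.re_le_norm _).trans h2
      nlinarith [norm_nonneg (w m)]
    · exact hux.congr fun m => (hwu m).symm
    · intro v hv
      refine (huf ⟨v.fst, fst_mem_dom_partialSum hv⟩).congr fun m => ?_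
      have e : (⟨(w m).fst, fst_mem_dom_partialSum (hw m)⟩ : (SesqForm.partialSum b n).dom) = u m :=
        Subtype.ext (hwu m)
      rw [inner_sumOp_eq_partialSum hM hT hq hv (hw m) fun k hk => Or.inr (hwt m k hk), e]
  · rintro ⟨w, hw, rfl, hwT⟩
    obtain ⟨a, ha, haw⟩ := mem_closure_iff_seq_limit.1 hw
    set S := sumOp H T hM hT
    have hfst : Tendsto (fun m => (a m).fst) atTop (𝓝 w.fst) :=
      ((WithLp.fstL 2 ℂ H (lp K 2)).continuous.tendsto w).comp haw
    have hS : Tendsto (fun m => S (a m)) atTop (𝓝 (S w)) := (S.continuous.tendsto w).comp haw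
    refine ⟨fun m => ⟨(a m).fst, fst_mem_dom_partialSum (ha m)⟩, hfst, ?_, fun v => ?_⟩
    · obtain ⟨C, hC⟩ := (Metric.isBounded_range_of_tendsto _ haw).exists_norm_le
      obtain ⟨D, hD⟩ := (Metric.isBounded_range_of_tendsto _ hS).exists_norm_le
      rw [isBounded_iff_forall_norm_le]
      refine ⟨C * D, ?_⟩
      rintro _ ⟨m, rfl⟩
      -- Cutting off the tail of `a m` on one side of the pairing suffices to recover the form
      -- value, and it does not increase the norm.
      obtain ⟨v, hv, hvu, hvt⟩ := exists_lift (q := q) (fst_mem_dom_partialSum (ha m))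
      have e : (⟨v.fst, fst_mem_dom_partialSum hv⟩ : (SesqForm.partialSum b n).dom) =
        ⟨(a m).fst, fst_mem_dom_partialSum (ha m)⟩ := Subtype.ext hvu
      have h1 := inner_sumOp_eq_partialSum hM hT hq hv (ha m) fun k hk => Or.inl (hvt k hk)
      rw [e] at h1
      have hsnd : ‖v.snd‖ ≤ ‖(a m).snd‖ := by
        refine lp.norm_mono (by simp) fun k => ?_
        rcases le_or_gt k n with hk | hk
        · obtain ⟨h1, e1⟩ := hv k hk
          obtain ⟨h2, e2⟩ := ha m k hk
          rw [e1, e2]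
          simp only [hvu, le_refl]
        · rw [hvt k hk, norm_zero]
          exact norm_nonneg _
      have hva : ‖v‖ ≤ ‖a m‖ := by
        refine (sq_le_sq₀ (norm_nonneg _) (norm_nonneg _)).1 ?_
        rw [WithLp.prod_norm_sq_eq_of_L2, WithLp.prod_norm_sq_eq_of_L2, hvu]
        gcongr
      beta_reduce
      rw [← h1]
      have hc : ‖a m‖ ≤ C := hC _ ⟨m, rfl⟩
      have hd : ‖S (a m)‖ ≤ D := hD _ ⟨m, rfl⟩
      refine (norm_inner_le_norm _ _).trans ?_
      exact mul_le_mul (hva.trans hc) hd (norm_nonneg _) ((norm_nonneg _).trans hc)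
    · obtain ⟨v', hv, hvu, hvt⟩ := exists_lift (q := q) v.2
      have e : (⟨v'.fst, fst_mem_dom_partialSum hv⟩ : (SesqForm.partialSum b n).dom) = v :=
        Subtype.ext hvu
      have h1 := hwT v' ((tailFreeSpace b q n).le_topologicalClosure hv)
      have h2 : Tendsto (fun m => inner ℂ v' (S (a m))) atTop (𝓝 (inner ℂ v' (S w))) :=
        tendsto_const_nhds.inner hS
      rw [h1] at h2
      change Tendsto _ _ (𝓝 (inner ℂ v'.fst f)) at h2
      rw [hvu] at h2
      refine h2.congr fun m => ?_
      rw [inner_sumOp_eq_partialSum hM hT hq hv (ha m) fun k hk => Or.inl (hvt k hk), e]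

end HilbertSum

/-! ### The limit graph. -/

theorem proposition3p4 {H : Type*} [NormedAddCommGroup H] [InnerProductSpace ℂ H]
    [CompleteSpace H] (θ : ℝ) (b : ℕ → SesqForm H)
    (hb : ∀ n, (b n).IsSectorialWith 0 θ)
    (A : ℕ → LinGraph H)
    (hA : ∀ n, A n = (SesqForm.partialSum b n).graph (SesqForm.partialSum_isSectorial hb n)) :
    ∃ A_inf : LinGraph H,
      (A_inf.IsMSectorial ∧ LinGraph.StrongResolventTendsto A A_inf) ∧
      (∀ B : LinGraph H, B.IsMSectorial → LinGraph.StrongResolventTendsto A B → B = A_inf) ∧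
      closure (SesqForm.limitDomain b) ⊆ closure A_inf.dom ∧
      (Dense (SesqForm.limitDomain b) → A_inf.IsSingleValued) := by
  have h0 := (hb 0).1
  have h1 := (hb 0).2.1
  have hM : 0 ≤ 2 * (1 + Real.tan θ) := by
    have := Real.tan_nonneg_of_nonneg_of_le_pi_div_two h0 h1.le
    positivity
  choose K i1 i2 i3 q T hT hq hTw using fun n => (hb n).exists_representation
  have hre : ∀ k w, (inner ℂ w (T k w)).re = ‖w‖ ^ 2 := fun k w => (hTw k w).1
  have hqn : ∀ k u, ‖q k u‖ ^ 2 = ((b k).form u u).re := fun k u => by rw [← hre, hq]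
  have hell := isElliptic_sumOp (H := H) hM hT hre
  let W : ℕ → Submodule ℂ (WithLp 2 (H × lp K 2)) := fun n =>
    (tailFreeSpace b q n).topologicalClosure
  have hW : ∀ n, IsClosed (W n : Set (WithLp 2 (H × lp K 2))) := fun n =>
    (tailFreeSpace b q n).isClosed_topologicalClosure
  have hanti : Antitone W := fun m n hmn =>
    Submodule.topologicalClosure_mono (antitone_tailFreeSpace hmn)
  have hinf : IsClosed ((⨅ n, W n : Submodule ℂ _) : Set (WithLp 2 (H × lp K 2))) := by
    rw [Submodule.coe_iInf]
    exact isClosed_iInter hW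
  have hAn : A = fun n => factoredGraph (WithLp.fstL 2 ℂ H (lp K 2)) (sumOp H T hM hT) (W n) := by
    funext n
    rw [hA n]
    exact SetLike.ext fun p => memGraph_partialSum_iff hM hT hq hre n p
  have hlim := hell.strongResolventTendsto hW hanti
  rw [← hAn] at hlim
  -- Only an inclusion is claimed: the intersection of the closures may exceed the closure of the
  -- intersection.
  have hdom : SesqForm.limitDomain b ⊆
      WithLp.fstL 2 ℂ H (lp K 2) '' (⨅ n, W n : Submodule ℂ (WithLp 2 (H × lp K 2))) := by
    intro u hu
    obtain ⟨w, hw, hwu⟩ := exists_lift_of_mem_limitDomain hqn hu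
    exact ⟨w, (Submodule.mem_iInf _).2 fun n =>
      (tailFreeSpace b q n).le_topologicalClosure (hw n), hwu⟩
  exact ⟨_, ⟨hell.isMSectorial hinf h0 h1
      (inner_sumOp_mem_sector hM hT h0 h1 hre fun k w => (hTw k w).2), hlim⟩,
    fun B _ hB => hB.unique hlim,
    closure_minimal (hdom.trans (hell.image_subset_closure_dom hinf)) isClosed_closure,
    fun hd => hell.isSingleValued (hd.mono hdom)⟩

end
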